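/- Let $R_0,\nu,C_0>0$, $\delta\in(1/2,1)$, $L=4R_0$ and $\Omega=[0,L]^3$. Let $H$ be the space of $\Omega$-periodic, divergence-free vector fields in $L^2(\Omega)^3$ with zero average, let $V\subset H$ be the subspace of fields whose weak first derivatives lie in $L^2(\Omega)$, and let $\|\cdot\|$ and $(\cdot,\cdot)$ be the norm and inner product of $L^2(\Omega)$. Let $f\in H$ be a time-independent force. For an open time interval $I$ ($I=(0,\infty)$ or $I=\mathbb R$), a Leray–Hopf solution on $I$ of the space-periodic 3D incompressible Navier–Stokes equations with viscosity $\nu$ and force $f$ is a function $u\in L^\infty(I,H)\cap L^2_{\rm loc}(I,V)$ such that, for every $v\in V$, $$\frac{d}{dt}(u,v)+\nu(\nabla u,\nabla v)-\int_\Omega ((u\cdot\nabla)v)\cdot u\,dx=(f,v)$$ in the sense of distributions on $I$, and such that, for almost every $t_0\in I$ and all $t_1\ge t_0$, $$\nu\int_{t_0}^{t_1}\|\nabla u\|^2\,dt\le\frac{\|u(t_0)\|^2}{2}-\frac{\|u(t_1)\|^2}{2}+\int_{t_0}^{t_1}(f,u)\,dt .$$ The weak global attractor $\mathcal A_w\subset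 H$ is the set of all values $v(t)$, $t\in\mathbb R$, of the (weakly continuous) Leray–Hopf solutions $v$ on $I=\mathbb R$. Let $T>0$ and let $\eta:\mathbb R\to[0,1]$ be a refined time cut-off on $[0,T]$, that is, $\eta$ is differentiable, $\operatorname{supp}\eta\subseteq[0,T]$ and $|\eta'|\le\frac{C_0}{T}\eta^{\delta}$. Let $u$ be a Leray–Hopf solution on $(0,\infty)$ and put $$e_0=\frac1T\frac1{R_0^3}\int_0^T\eta^{\delta}\,\frac{\|u\|^2}{2}\,dt,\qquad \varepsilon_0=\frac1T\frac1{R_0^3}\,\nu\int_0^T\eta\,\|\nabla u\|^2\,dt+\varepsilon_\infty ,$$ where the anomalous dissipation $\varepsilon_\infty$ is determined by the energy balance $$\varepsilon_0=\frac1T\frac1{R_0^3}\int_0^T\eta'\,\frac{\|u\|^2}{2}\,dt+\frac1T\frac1{R_0^3}\int_0^T\eta\,(f,u)\,dt .$$ Assume that $u(t)\in\mathcal A_w$ for all $t\in[0,T]$ and that $$T\ge\frac{2C_0}{\pi^2}\frac{R_0^2}{\nu}.$$ Then $\eta\|\nabla u\|^2$ is integrable on $[0,T]$, $\varepsilon_\infty\ge0$,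 and $$\varepsilon_0\le 2\sqrt2\,\frac{\|f\|}{R_0^{3/2}}\,e_0^{1/2}.$$ -/

import Mathlib

open MeasureTheory
open scoped ContDiff

noncomputable section

namespace PeriodicNSE

/-- Three-dimensional Euclidean space. -/
abbrev E3 : Type := EuclideanSpace ℝ (Fin 3)

/-- The `j`-th standard basis vector. -/
def basisVec (j : Fin 3) : E3 := EuclideanSpace.single j (1 : ℝ)

/-- The periodic box `Ω = [0, L]³`. -/
def box (L : ℝ) : Set E3 := {x | ∀ i, x i ∈ Set.Icc (0 : ℝ) L}

/-- Square-integrable vector fields on `Ω`, that is, `Ω`-periodic, locally square-integrable vector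
fields. The norm and the inner product are `‖·‖` and `(·,·)` of `L²(Ω)`. -/
abbrev L2Field (L : ℝ) : Type := Lp E3 2 (volume.restrict (box L))

/-- Smooth `Ω`-periodic scalar test functions on `ℝ³`. -/
structure IsPeriodicTest (L : ℝ) (φ : E3 → ℝ) : Prop where
  smooth : ContDiff ℝ ∞ φ
  periodic : ∀ (i : Fin 3) (x : E3), φ (x + L • basisVec i) = φ x

/-- The space `H`: periodic `L²` fields that are divergence free (in the sense of periodic
distributions) and have zero average. -/
def spaceH (L : ℝ) : Set (L2Field L) :=
  {w | (∀ φ : E3 → ℝ, IsPeriodicTest L φ →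
          ∫ x in box L, inner ℝ (w x) (gradient φ x) = 0) ∧
        ∫ x in box L, w x = 0}

/-- `g` is the weak derivative `∂_j w` of the periodic field `w`. -/
def IsWeakPartial {L : ℝ} (j : Fin 3) (w g : L2Field L) : Prop :=
  ∀ φ : E3 → ℝ, IsPeriodicTest L φ →
    ∫ x in box L, (fderiv ℝ φ x (basisVec j)) • w x = -∫ x in box L, φ x • g x

/-- The space `V = D(A^{1/2})`: the fields in `H` with weak first derivatives in `L²`. -/
def spaceV (L : ℝ) : Set (L2Field L) :=
  {w | w ∈ spaceH L ∧ ∀ j, ∃ g : L2Field L, IsWeakPartial j w g}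

open Classical in
/-- The weak derivative `∂_j w ∈ L²` (which is unique when it exists; the value is `0` if there is
none). -/
def weakPartial {L : ℝ} (j : Fin 3) (w : L2Field L) : L2Field L :=
  if h : ∃ g : L2Field L, IsWeakPartial j w g then h.choose else 0

/-- `‖∇w‖² = ∑_j ‖∂_j w‖²`, for `w ∈ V`. -/
def gradNormSq {L : ℝ} (w : L2Field L) : ℝ := ∑ j, ‖weakPartial j w‖ ^ 2

/-- `(A^{1/2} w, A^{1/2} v) = (∇w, ∇v)`, for `w, v ∈ V`. -/
def gradInner {L : ℝ} (w v : L2Field L) : ℝ :=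
  ∑ j, inner ℝ (weakPartial j w) (weakPartial j v)

/-- `(B(w, v), z) = ∫_Ω ((w · ∇) v) · z`, for `w, v, z ∈ V`. -/
def trilinear {L : ℝ} (w v z : L2Field L) : ℝ :=
  ∫ x in box L, ∑ j, w x j * inner ℝ (weakPartial j v x) (z x)

/-- `u` is a Leray–Hopf solution, on the time set `I`, of the space-periodic Navier–Stokes equations
with viscosity `ν` and time-independent force `f`. It is used for `I = (0, ∞)` and for `I = ℝ`. -/
structure IsLerayHopfOn {L : ℝ} (ν : ℝ) (f : L2Field L) (I : Set ℝ) (u : ℝ → L2Field L) :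
    Prop where
  /-- `u` takes its values in `H` -/
  mem_H : ∀ t ∈ I, u t ∈ spaceH L
  /-- `u ∈ L^∞(I, H)` -/
  bounded : MemLp u ⊤ (volume.restrict I)
  /-- `u ∈ L²_loc(I, V)` -/
  mem_V : ∀ᵐ t ∂(volume.restrict I), u t ∈ spaceV L
  sq_integrable : ∀ K ⊆ I, IsCompact K →
    ∀ j, MemLp (fun t => weakPartial j (u t)) 2 (volume.restrict K)
  /-- `(u,v)_t + ν (A^{1/2}u, A^{1/2}v) - (B(u,v),u) = (f,v)` in the sense of distributions on `I`,
  for every `v ∈ V` -/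
  weak_form : ∀ v ∈ spaceV L, ∀ χ : ℝ → ℝ, ContDiff ℝ ∞ χ → HasCompactSupport χ → tsupport χ ⊆ I →
    -(∫ t, deriv χ t * inner ℝ (u t) v) + ν * (∫ t, χ t * gradInner (u t) v)
        - (∫ t, χ t * trilinear (u t) v (u t))
      = ∫ t, χ t * inner ℝ f v
  /-- the Leray–Hopf energy inequality, for a.e. `t₀` and all `t₁ ≥ t₀` -/
  energy : ∀ᵐ t₀ ∂(volume.restrict I), ∀ t₁ ∈ I, t₀ ≤ t₁ →
    ν * (∫ t in t₀..t₁, gradNormSq (u t))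
      ≤ ‖u t₀‖ ^ 2 / 2 - ‖u t₁‖ ^ 2 / 2 + ∫ t in t₀..t₁, inner ℝ f (u t)

/-- The weak global attractor: all values of the global (forward and backward in time), bounded
Leray–Hopf solutions. Values at single times are those of the weakly continuous representative;
by translation in time it is enough to take the values at time `0`. -/
def weakAttractor {L : ℝ} (ν : ℝ) (f : L2Field L) : Set (L2Field L) :=
  {w | ∃ v : ℝ → L2Field L, IsLerayHopfOn ν f Set.univ v ∧
        (∀ z : L2Field L, Continuous fun t => inner ℝ (v t) z) ∧ v 0 = w}

/-- Refined time cut-offs on `[0, T]`, with parameters `C₀` and `δ`. -/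
structure IsRefinedTimeCutoff (C₀ δ T : ℝ) (η : ℝ → ℝ) : Prop where
  differentiable : Differentiable ℝ η
  nonneg : ∀ t, 0 ≤ η t
  le_one : ∀ t, η t ≤ 1
  support_subset : tsupport η ⊆ Set.Icc 0 T
  deriv_bound : ∀ t, |deriv η t| ≤ C₀ / T * η t ^ δ

/-- The global energy `e₀`. -/
def globalEnergy {L : ℝ} (R₀ δ T : ℝ) (η : ℝ → ℝ) (u : ℝ → L2Field L) : ℝ :=
  1 / T * (1 / R₀ ^ 3) * ∫ t in (0 : ℝ)..T, η t ^ δ * (‖u t‖ ^ 2 / 2)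

/-- The viscous part of the global dissipation rate. -/
def viscousDissipation {L : ℝ} (R₀ ν T : ℝ) (η : ℝ → ℝ) (u : ℝ → L2Field L) : ℝ :=
  1 / T * (1 / R₀ ^ 3) * (ν * ∫ t in (0 : ℝ)..T, η t * gradNormSq (u t))

/-- The right-hand side of the time-localized global energy balance. -/
def balanceRate {L : ℝ} (R₀ T : ℝ) (f : L2Field L) (η : ℝ → ℝ) (u : ℝ → L2Field L) : ℝ :=
  1 / T * (1 / R₀ ^ 3) * (∫ t in (0 : ℝ)..T, deriv η t * (‖u t‖ ^ 2 / 2))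
    + 1 / T * (1 / R₀ ^ 3) * (∫ t in (0 : ℝ)..T, η t * inner ℝ f (u t))

/-- The anomalous dissipation `ε_∞`: the number that turns the energy inequality into a balance. -/
def anomalousDissipation {L : ℝ} (R₀ ν T : ℝ) (f : L2Field L) (η : ℝ → ℝ)
    (u : ℝ → L2Field L) : ℝ :=
  balanceRate R₀ T f η u - viscousDissipation R₀ ν T η u

/-- The total (viscous + anomalous) global dissipation rate `ε₀`. -/
def globalDissipation {L : ℝ} (R₀ ν T : ℝ) (f : L2Field L) (η : ℝ → ℝ)
    (u : ℝ → L2Field L) : ℝ :=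
  viscousDissipation R₀ ν T η u + anomalousDissipation R₀ ν T f η u

end PeriodicNSE

end

/-! The estimate rests on an absorbing ball. By the sharp Poincaré inequality with constant
`(2π/L)²`, proved from Parseval's identity, and by Young's inequality, a global Leray–Hopf solution
`v` satisfies an integrated decay inequality for `‖v‖² - (‖f‖/a)²` at rate `a = ν(2π/L)²`. If this
quantity were positive at some time, it would exceed every bound at earlier times. So `‖u‖ ≤ ‖f‖/a`
on the attractor (`norm_le_of_mem_weakAttractor`).

Put `X = ∫ η^δ ‖u‖²`, so that `e₀ = X/(2TR₀³)`. By Cauchy–Schwarz and `η ≤ η^(δ/2)`, the force term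
is at most `‖f‖ √(TX)`. The cut-off term is at most `(C₀/T) X/2`; the lower bound on `T` says
exactly `C₀/T ≤ 2a`, so it is at most `aX`. The absorbing ball gives `X ≤ T(‖f‖/a)²`, hence again
`aX ≤ ‖f‖ √(TX)`. The two equal bounds add up to the constant `2√2`.

The sign of the anomalous dissipation is the energy inequality tested against `η`
(`integral_cutoff_mul_le`): kinetic energy plus accumulated dissipation minus work is nonincreasing
from almost every time on. -/

noncomputable section

namespace PeriodicNSE

-- Fourier modes and Parseval's identity on the box

local instance : MeasureSpace UnitAddCircle := ⟨AddCircle.haarAddCircle⟩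

local instance : IsProbabilityMeasure (volume : Measure UnitAddCircle) :=
  inferInstanceAs (IsProbabilityMeasure AddCircle.haarAddCircle)

/-- The phase `2π/L (n · x)` of the `n`-th Fourier mode of the box. -/
def phase (L : ℝ) (n : Fin 3 → ℤ) (x : E3) : ℝ := 2 * Real.pi / L * ∑ i, (n i : ℝ) * x i

/-- The section of the covering of the torus by `ℝ³` with values in the box `(0, L]³`. -/
def torusSection (L : ℝ) (t : UnitAddTorus (Fin 3)) : E3 :=
  L • WithLp.toLp 2 (fun i => ((AddCircle.equivIoc 1 0 (t i)).1 : ℝ))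

lemma box_eq_preimage (L : ℝ) :
    box L = (@WithLp.ofLp 2 (Fin 3 → ℝ)) ⁻¹' Set.Icc (fun _ => 0) (fun _ => L) := by
  ext x
  simp [box, Set.mem_Icc, Pi.le_def, forall_and]

lemma Ioc_box_ae_eq (L : ℝ) :
    {x : E3 | ∀ i, x i ∈ Set.Ioc (0 : ℝ) L} =ᵐ[volume] box L := by
  have h := (PiLp.volume_preserving_ofLp (Fin 3)).quasiMeasurePreserving.preimage_ae_eq
    (Measure.univ_pi_Ioc_ae_eq_Icc (μ := fun _ : Fin 3 => (volume : Measure ℝ))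
      (f := fun _ => 0) (g := fun _ => L))
  rw [box_eq_preimage]
  have hs : {x : E3 | ∀ i, x i ∈ Set.Ioc (0 : ℝ) L} =
      (@WithLp.ofLp 2 (Fin 3 → ℝ)) ⁻¹' Set.univ.pi fun _ => Set.Ioc 0 L := by
    ext x; simp
  rw [hs]
  exact h

instance isFiniteMeasure_box (L : ℝ) : IsFiniteMeasure (volume.restrict (box L) : Measure E3) := by
  refine isFiniteMeasure_restrict.2 (ne_of_lt ?_)
  rw [box_eq_preimage, (PiLp.volume_preserving_ofLp (Fin 3)).measure_preimage
    measurableSet_Icc.nullMeasurableSet]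
  exact isCompact_Icc.measure_lt_top

lemma measurePreserving_torusSection {L : ℝ} (hL : 0 < L) :
    MeasurePreserving (torusSection L) volume
      (ENNReal.ofReal ((L ^ 3)⁻¹) • (volume.restrict (box L) : Measure E3)) := by
  have h1 := UnitAddTorus.measurePreserving_equivPiIoc (d := Fin 3) (fun _ => 0)
  have hm : MeasurableSet {x : Fin 3 → ℝ | ∀ i, x i ∈ Set.Ioc (0 : ℝ) (0 + 1)} :=
    MeasurableSet.univ_pi' fun i => measurableSet_Ioc
  have h2 := measurePreserving_subtype_coe (μa := (volume : Measure (Fin 3 → ℝ))) hm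
  have h3 := (PiLp.volume_preserving_toLp (Fin 3)).restrict_preimage_emb
    (MeasurableEquiv.toLp 2 (Fin 3 → ℝ)).measurableEmbedding
    {x : E3 | ∀ i, x i ∈ Set.Ioc (0 : ℝ) (0 + 1)}
  have hscale : MeasurePreserving (fun x : E3 => L • x)
      (volume.restrict {x : E3 | ∀ i, x i ∈ Set.Ioc (0 : ℝ) (0 + 1)})
      (ENNReal.ofReal ((L ^ 3)⁻¹) • (volume.restrict (box L) : Measure E3)) := by
    refine ⟨by fun_prop, ?_⟩
    have he : MeasurableEmbedding (fun x : E3 => L • x) :=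
      (Homeomorph.smulOfNeZero L hL.ne').measurableEmbedding
    have hpre : {x : E3 | ∀ i, x i ∈ Set.Ioc (0 : ℝ) (0 + 1)} =
        (fun x : E3 => L • x) ⁻¹' {x : E3 | ∀ i, x i ∈ Set.Ioc (0 : ℝ) L} := by
      ext x
      simp [hL, mul_le_iff_le_one_right]
    -- Dilation by `L` pushes volume to `L⁻³` times volume, the source of the normalizing factor;
    -- the half-open and closed boxes differ by a null set.
    rw [hpre, ← he.restrict_map, Measure.map_addHaar_smul _ hL.ne', Measure.restrict_smul,
      Measure.restrict_congr_set (Ioc_box_ae_eq L)]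
    simp [abs_of_pos hL]
  exact hscale.comp (h3.comp (h2.comp h1))

lemma mFourier_torusSection {L : ℝ} (hL : 0 < L) (n : Fin 3 → ℤ) (t : UnitAddTorus (Fin 3)) :
    UnitAddTorus.mFourier n t
      = Complex.exp (phase L n (torusSection L t) * Complex.I) := by
  have h : ∀ i, fourier (n i) (t i)
      = Complex.exp (2 * Real.pi * Complex.I * n i * (AddCircle.equivIoc 1 0 (t i)).1 / 1) := by
    intro i
    conv_lhs => rw [← (AddCircle.equivIoc 1 0).symm_apply_apply (t i)]
    exact fourier_coe_apply'
  simp only [UnitAddTorus.mFourier, ContinuousMap.coe_mk, h, ← Complex.exp_sum]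
  congr 1
  have hL' : (L : ℂ) ≠ 0 := by exact_mod_cast hL.ne'
  simp only [phase, torusSection, PiLp.smul_apply, smul_eq_mul]
  push_cast
  simp only [Finset.mul_sum, Finset.sum_mul]
  refine Finset.sum_congr rfl fun i _ => ?_
  field_simp

lemma contDiff_phase (L : ℝ) (n : Fin 3 → ℤ) : ContDiff ℝ ∞ (phase L n) := by
  unfold phase
  fun_prop

lemma phase_add_period {L : ℝ} (hL : 0 < L) (n : Fin 3 → ℤ) (i : Fin 3) (x : E3) :
    phase L n (x + L • basisVec i) = phase L n x + n i * (2 * Real.pi) := by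
  have h : ∑ j, (n j : ℝ) * (x + L • basisVec i) j = (∑ j, (n j : ℝ) * x j) + n i * L := by
    simp [basisVec, mul_add, Finset.sum_add_distrib]
  simp only [phase, h]
  field_simp

lemma fderiv_phase (L : ℝ) (n : Fin 3 → ℤ) (x : E3) (j : Fin 3) :
    fderiv ℝ (phase L n) x (basisVec j) = 2 * Real.pi / L * n j := by
  have h : phase L n = fun x => ((2 * Real.pi / L) • ∑ i, (n i : ℝ) •
      (EuclideanSpace.proj i : E3 →L[ℝ] ℝ)) x := by
    ext x; simp [phase]
  rw [h, ContinuousLinearMap.fderiv]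
  simp [basisVec]

lemma phase_neg (L : ℝ) (n : Fin 3 → ℤ) (x : E3) : phase L (-n) x = -phase L n x := by
  simp [phase]

lemma isPeriodicTest_cos {L : ℝ} (hL : 0 < L) (n : Fin 3 → ℤ) :
    IsPeriodicTest L (fun x => Real.cos (phase L n x)) where
  smooth := Real.contDiff_cos.comp (contDiff_phase L n)
  periodic i x := by rw [phase_add_period hL, Real.cos_add_int_mul_two_pi]

lemma isPeriodicTest_sin {L : ℝ} (hL : 0 < L) (n : Fin 3 → ℤ) :
    IsPeriodicTest L (fun x => Real.sin (phase L n x)) where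
  smooth := Real.contDiff_sin.comp (contDiff_phase L n)
  periodic i x := by rw [phase_add_period hL, Real.sin_add_int_mul_two_pi]

lemma fderiv_cos_phase (L : ℝ) (n : Fin 3 → ℤ) (x : E3) (j : Fin 3) :
    fderiv ℝ (fun x => Real.cos (phase L n x)) x (basisVec j)
      = -(2 * Real.pi / L * n j) * Real.sin (phase L n x) := by
  have hd : DifferentiableAt ℝ (phase L n) x := (contDiff_phase L n).differentiable (by simp) x
  rw [fderiv_cos hd]
  simp [fderiv_phase]
  ring

lemma fderiv_sin_phase (L : ℝ) (n : Fin 3 → ℤ) (x : E3) (j : Fin 3) :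
    fderiv ℝ (fun x => Real.sin (phase L n x)) x (basisVec j)
      = (2 * Real.pi / L * n j) * Real.cos (phase L n x) := by
  have hd : DifferentiableAt ℝ (phase L n) x := (contDiff_phase L n).differentiable (by simp) x
  rw [fderiv_sin hd]
  simp [fderiv_phase]
  ring

lemma integrable_cos_phase_mul {L : ℝ} {μ : Measure E3} (n : Fin 3 → ℤ) {g : E3 → ℝ}
    (hg : Integrable g μ) : Integrable (fun x => Real.cos (phase L n x) * g x) μ :=
  hg.bdd_mul (c := 1)
    (Real.continuous_cos.comp (contDiff_phase L n).continuous).aestronglyMeasurable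
    (Filter.Eventually.of_forall fun x => by simpa using Real.abs_cos_le_one _)

lemma integrable_sin_phase_mul {L : ℝ} {μ : Measure E3} (n : Fin 3 → ℤ) {g : E3 → ℝ}
    (hg : Integrable g μ) : Integrable (fun x => Real.sin (phase L n x) * g x) μ :=
  hg.bdd_mul (c := 1)
    (Real.continuous_sin.comp (contDiff_phase L n).continuous).aestronglyMeasurable
    (Filter.Eventually.of_forall fun x => by simpa using Real.abs_sin_le_one _)

/-- The squared modulus of the (unnormalized) `n`-th Fourier coefficient of `g` on the box. -/
def modeEnergy (L : ℝ) (g : E3 → ℝ) (n : Fin 3 → ℤ) : ℝ :=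
  (∫ x in box L, Real.cos (phase L n x) * g x) ^ 2
    + (∫ x in box L, Real.sin (phase L n x) * g x) ^ 2

lemma norm_sq_integral_exp_phase {L : ℝ} (n : Fin 3 → ℤ) {g : E3 → ℝ}
    (hg : Integrable g (volume.restrict (box L))) :
    ‖∫ x in box L, Complex.exp (phase L (-n) x * Complex.I) * (g x : ℂ)‖ ^ 2
      = modeEnergy L g n := by
  have h : (fun x => Complex.exp (phase L (-n) x * Complex.I) * (g x : ℂ))
      = fun x => ((Real.cos (phase L n x) * g x : ℝ) : ℂ)
          - ((Real.sin (phase L n x) * g x : ℝ) : ℂ) * Complex.I := by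
    ext x
    rw [Complex.exp_mul_I, phase_neg]
    push_cast
    rw [Complex.cos_neg, Complex.sin_neg]
    ring
  rw [h, integral_sub (integrable_cos_phase_mul n hg).ofReal
    ((integrable_sin_phase_mul n hg).ofReal.mul_const _), integral_mul_const,
    integral_complex_ofReal, integral_complex_ofReal, Complex.sq_norm, Complex.normSq_apply,
    modeEnergy]
  simp
  ring

lemma integral_comp_torusSection {F : Type*} [NormedAddCommGroup F] [NormedSpace ℝ F] {L : ℝ}
    (hL : 0 < L) {g : E3 → F} (hg : AEStronglyMeasurable g (volume.restrict (box L))) :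
    ∫ t, g (torusSection L t) = (L ^ 3)⁻¹ • ∫ x in box L, g x := by
  have hs := measurePreserving_torusSection hL
  have h := integral_map hs.measurable.aemeasurable (f := g)
    (by rw [hs.map_eq]; exact hg.smul_measure _)
  rw [← h, hs.map_eq, integral_smul_measure, ENNReal.toReal_ofReal (by positivity)]

/-- Parseval's identity on the box. -/
lemma hasSum_modeEnergy {L : ℝ} (hL : 0 < L) {g : E3 → ℝ}
    (hg : MemLp g 2 (volume.restrict (box L))) :
    HasSum (modeEnergy L g) (L ^ 3 * ∫ x in box L, g x ^ 2) := by
  have hs := measurePreserving_torusSection hL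
  have hgc : MemLp (fun x => (g x : ℂ))
      2 (ENNReal.ofReal ((L ^ 3)⁻¹) • (volume.restrict (box L) : Measure E3)) :=
    hg.ofReal.smul_measure ENNReal.ofReal_ne_top
  have hG : MemLp ((fun x => (g x : ℂ)) ∘ torusSection L) 2 volume :=
    hgc.comp_measurePreserving hs
  have hP := UnitAddTorus.hasSum_sq_mFourierCoeff (hG.toLp _)
  have hcoef : ∀ n, ‖UnitAddTorus.mFourierCoeff (hG.toLp _) n‖ ^ 2
      = ((L ^ 3)⁻¹) ^ 2 * modeEnergy L g n := by
    intro n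
    have h1 : UnitAddTorus.mFourierCoeff (hG.toLp _) n
        = ∫ t, (fun x => Complex.exp (phase L (-n) x * Complex.I) * (g x : ℂ))
            (torusSection L t) := by
      refine integral_congr_ae ?_
      filter_upwards [hG.coeFn_toLp] with t ht
      rw [ht, mFourier_torusSection hL, smul_eq_mul]
      rfl
    have hcont : Continuous (fun x : E3 => Complex.exp (phase L (-n) x * Complex.I)) := by
      have := (contDiff_phase L (-n)).continuous
      fun_prop
    rw [h1, integral_comp_torusSection hL
      (g := fun x => Complex.exp (phase L (-n) x * Complex.I) * (g x : ℂ))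
      (hcont.aestronglyMeasurable.mul hg.ofReal.aestronglyMeasurable),
      norm_smul, mul_pow, norm_sq_integral_exp_phase n (hg.integrable (by norm_num)),
      Real.norm_of_nonneg (by positivity)]
  have hnorm : ∫ t, ‖(hG.toLp _ : UnitAddTorus (Fin 3) → ℂ) t‖ ^ 2
      = (L ^ 3)⁻¹ * ∫ x in box L, g x ^ 2 := by
    have h1 : ∫ t, ‖(hG.toLp _ : UnitAddTorus (Fin 3) → ℂ) t‖ ^ 2
        = ∫ t, (fun x => g x ^ 2) (torusSection L t) := by
      refine integral_congr_ae ?_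
      filter_upwards [hG.coeFn_toLp] with t ht
      rw [ht]
      simp
    rw [h1, integral_comp_torusSection hL (g := fun x => g x ^ 2)
      (hg.aestronglyMeasurable.pow 2), smul_eq_mul]
  rw [hnorm] at hP
  simp only [hcoef] at hP
  have hL3 : (L ^ 3) * (L ^ 3)⁻¹ = 1 := mul_inv_cancel₀ (by positivity)
  -- Clears the two factors `L⁻³` of each squared coefficient; one factor `L³` survives on the
  -- right.
  have hP' := hP.mul_left ((L ^ 3) ^ 2)
  simp only [← mul_assoc, ← mul_pow, hL3, one_pow, one_mul] at hP'
  rwa [pow_two, mul_assoc (L ^ 3), hL3, mul_one] at hP'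

/-! ### The Poincaré inequality -/

/-- The Fourier coefficients of a weak derivative. -/
lemma modeEnergy_weakPartial {L : ℝ} (hL : 0 < L) {j : Fin 3} {w g : L2Field L}
    (h : IsWeakPartial j w g) (i : Fin 3) (n : Fin 3 → ℤ) :
    modeEnergy L (fun x => g x i) n
      = (2 * Real.pi / L * n j) ^ 2 * modeEnergy L (fun x => w x i) n := by
  have hint : ∀ v : L2Field L, Integrable v (volume.restrict (box L)) :=
    fun v => (Lp.memLp v).integrable (by norm_num)
  have hcoord : ∀ (φ : E3 → ℝ) (v : L2Field L), Continuous φ → (∀ x, |φ x| ≤ 1) →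
      (∫ x in box L, φ x • v x) i = ∫ x in box L, φ x * v x i := by
    intro φ v hφ hb
    have h1 : Integrable (fun x => φ x • v x) (volume.restrict (box L)) :=
      (hint v).bdd_smul 1 hφ.aestronglyMeasurable
        (Filter.Eventually.of_forall fun x => by simpa using hb x)
    have h2 := (EuclideanSpace.proj i : E3 →L[ℝ] ℝ).integral_comp_comm h1
    simpa using h2.symm
  have hcc : Continuous fun x => Real.cos (phase L n x) :=
    (isPeriodicTest_cos hL n).smooth.continuous
  have hsc : Continuous fun x => Real.sin (phase L n x) :=
    (isPeriodicTest_sin hL n).smooth.continuous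
  -- Differentiation swaps cosine and sine up to sign and the factor `2π n_j/L`, so the two real
  -- coefficients trade places; the sum of squares hides the swap and the sign.
  have e1 := congrArg (fun v : E3 => v i) (h _ (isPeriodicTest_cos hL n))
  have e2 := congrArg (fun v : E3 => v i) (h _ (isPeriodicTest_sin hL n))
  simp only [fderiv_cos_phase, fderiv_sin_phase, mul_smul, integral_smul, PiLp.smul_apply,
    PiLp.neg_apply, smul_eq_mul,
    hcoord _ _ hcc (fun _ => Real.abs_cos_le_one _),
    hcoord _ _ hsc (fun _ => Real.abs_sin_le_one _)] at e1 e2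
  unfold modeEnergy
  rw [← neg_eq_iff_eq_neg] at e1 e2
  rw [← e1, ← e2]
  ring

lemma modeEnergy_nonneg (L : ℝ) (g : E3 → ℝ) (n : Fin 3 → ℤ) : 0 ≤ modeEnergy L g n := by
  unfold modeEnergy; positivity

lemma memLp_coord {L : ℝ} (w : L2Field L) (i : Fin 3) :
    MemLp (fun x => w x i) 2 (volume.restrict (box L)) :=
  (EuclideanSpace.proj i : E3 →L[ℝ] ℝ).comp_memLp' (Lp.memLp w)

lemma norm_sq_eq_sum_coord {L : ℝ} (w : L2Field L) :
    ‖w‖ ^ 2 = ∑ i, ∫ x in box L, w x i ^ 2 := by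
  rw [← real_inner_self_eq_norm_sq, L2.inner_def,
    ← integral_finsetSum _ fun i _ => (memLp_coord w i).integrable_sq]
  refine integral_congr_ae (Filter.Eventually.of_forall fun x => ?_)
  simp [EuclideanSpace.norm_sq_eq]

lemma isWeakPartial_weakPartial {L : ℝ} {w : L2Field L} (hw : w ∈ spaceV L) (j : Fin 3) :
    IsWeakPartial j w (weakPartial j w) := by
  have h := hw.2 j
  rw [weakPartial, dif_pos h]
  exact h.choose_spec

lemma modeEnergy_zero {L : ℝ} {w : L2Field L} (hw : w ∈ spaceH L) (i : Fin 3) :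
    modeEnergy L (fun x => w x i) 0 = 0 := by
  have h1 := (EuclideanSpace.proj i : E3 →L[ℝ] ℝ).integral_comp_comm
    ((Lp.memLp w).integrable (by norm_num))
  rw [hw.2] at h1
  have h2 : ∫ x in box L, w x i = 0 := by simpa using h1
  simp [modeEnergy, phase, h2]

/-- The sharp Poincaré inequality on the box. -/
theorem poincare {L : ℝ} (hL : 0 < L) {w : L2Field L} (hw : w ∈ spaceV L) :
    (2 * Real.pi / L) ^ 2 * ‖w‖ ^ 2 ≤ gradNormSq w := by
  have key : ∀ i, (2 * Real.pi / L) ^ 2 * ∫ x in box L, w x i ^ 2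
      ≤ ∑ j, ∫ x in box L, weakPartial j w x i ^ 2 := by
    intro i
    have h1 := (hasSum_modeEnergy hL (memLp_coord w i)).mul_left ((2 * Real.pi / L) ^ 2)
    have h2 := hasSum_sum (s := Finset.univ) fun (j : Fin 3) _ =>
      hasSum_modeEnergy hL (memLp_coord (weakPartial j w) i)
    -- Mode by mode: the zero mode vanishes by zero average, and any other `n` has an integer
    -- component with `n_k² ≥ 1`.
    have h3 := hasSum_le (fun n => ?_) h1 h2
    · rw [← Finset.mul_sum] at h3
      have : (0 : ℝ) < L ^ 3 := by positivity
      nlinarith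
    · simp only [modeEnergy_weakPartial hL (isWeakPartial_weakPartial hw _), ← Finset.sum_mul]
      by_cases hn : n = 0
      · subst hn
        simp [modeEnergy_zero hw.1]
      · refine mul_le_mul_of_nonneg_right ?_ (modeEnergy_nonneg _ _ _)
        obtain ⟨k, hk⟩ := Function.ne_iff.1 hn
        have hk1 : (1 : ℝ) ≤ (n k : ℝ) ^ 2 := by
          have : (1 : ℤ) ≤ n k ^ 2 := by have := sq_pos_of_ne_zero hk; omega
          exact_mod_cast this
        refine le_trans ?_ (Finset.single_le_sum
          (f := fun j => (2 * Real.pi / L * (n j : ℝ)) ^ 2) (fun j _ => sq_nonneg _)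
          (Finset.mem_univ k))
        rw [mul_pow]
        exact le_mul_of_one_le_right (sq_nonneg _) hk1
  have hsum := Finset.sum_le_sum fun i (_ : i ∈ Finset.univ) => key i
  rw [← Finset.mul_sum, ← norm_sq_eq_sum_coord, Finset.sum_comm] at hsum
  simpa only [gradNormSq, norm_sq_eq_sum_coord] using hsum

/-! ### The absorbing ball -/

/-- A function on the line that is bounded and decays along its own integral is nonpositive. -/
lemma nonpos_of_bounded_of_decay {a B M : ℝ} (ha : 0 < a) (hB : 0 ≤ B) {z : ℝ → ℝ}
    (hint : ∀ s t, IntervalIntegrable z volume s t) (hlow : ∀ t, -B ≤ z t)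
    (hup : ∀ᵐ t, z t ≤ M)
    (hz : ∀ᵐ s, ∀ t, s ≤ t → z t + a * ∫ r in s..t, z r ≤ z s) (t : ℝ) : z t ≤ 0 := by
  by_contra! hc
  set c := z t with hcdef
  -- A time span so short that the lower bound `-B` costs at most `c/2`; the `+ 1` keeps the
  -- denominator positive when `B = 0`.
  set h := c / (2 * a * (B + 1)) with hh
  have hpos : 0 < h := by positivity
  have hsmall : a * (B * h) ≤ c / 2 := by
    have : a * ((B + 1) * h) = c / 2 := by rw [hh]; field_simp
    nlinarith [mul_pos ha hpos]
  -- Going back by less than `h` keeps `z ≥ z t₁ / 2` almost everywhere. Integrating this over a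
  -- length of at least `h/2` gains a fixed amount. The earlier time is taken where both
  -- almost-everywhere hypotheses hold.
  have step : ∀ t₁, c ≤ z t₁ → ∃ t₀, z t₁ + a * h / 4 * c ≤ z t₀ ∧ z t₀ ≤ M := by
    intro t₁ h1
    obtain ⟨t₀, ⟨hg, hM⟩, ht₀⟩ := (Measure.dense_of_ae (hz.and hup)).exists_between
      (show t₁ - h < t₁ - h / 2 by linarith)
    refine ⟨t₀, ?_, hM⟩
    have hle : t₀ ≤ t₁ := by linarith [ht₀.2]
    have hmean : ∫ _r in t₀..t₁, z t₁ / 2 ≤ ∫ r in t₀..t₁, z r := by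
      refine intervalIntegral.integral_mono_ae_restrict hle intervalIntegrable_const (hint _ _) ?_
      filter_upwards [ae_restrict_of_ae hz, ae_restrict_mem measurableSet_Icc] with s hs hs'
      have h2 : ∫ _r in s..t₁, -B ≤ ∫ r in s..t₁, z r :=
        intervalIntegral.integral_mono_on hs'.2 intervalIntegrable_const (hint _ _)
          fun r _ => hlow r
      rw [intervalIntegral.integral_const, smul_eq_mul] at h2
      have h3 : (t₁ - s) * B ≤ h * B :=
        mul_le_mul_of_nonneg_right (by linarith [ht₀.1, hs'.1]) hB
      have h4 : a * (-(B * h)) ≤ a * ∫ r in s..t₁, z r :=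
        mul_le_mul_of_nonneg_left (by linarith) ha.le
      have h5 := hs t₁ hs'.2
      linarith
    rw [intervalIntegral.integral_const, smul_eq_mul] at hmean
    have h6 : h / 2 * (c / 2) ≤ (t₁ - t₀) * (z t₁ / 2) :=
      mul_le_mul (by linarith [ht₀.2]) (by linarith) (by positivity) (by linarith)
    have h7 := mul_le_mul_of_nonneg_left (h6.trans hmean) ha.le
    linarith [hg t₁ hle]
  have hk : 0 < a * h / 4 * c := by positivity
  have iter : ∀ n : ℕ, ∃ s, c + n * (a * h / 4 * c) ≤ z s := by
    intro n
    induction n with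
    | zero => exact ⟨t, by simp [hcdef]⟩
    | succ n ih =>
      obtain ⟨s, hs⟩ := ih
      obtain ⟨s', hs', -⟩ := step s (by nlinarith [(Nat.cast_nonneg n : (0 : ℝ) ≤ n)])
      exact ⟨s', by push_cast; linarith⟩
  obtain ⟨n, hn⟩ := exists_nat_gt (M / (a * h / 4 * c))
  rw [div_lt_iff₀ hk] at hn
  obtain ⟨s, hs⟩ := iter n
  -- One more step, because `z ≤ M` is known only at the times that `step` produces.
  obtain ⟨s', hs', hM⟩ := step s (by nlinarith [(Nat.cast_nonneg n : (0 : ℝ) ≤ n)])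
  linarith

lemma exists_ae_norm_le {α E : Type*} [MeasurableSpace α] [NormedAddCommGroup E] {μ : Measure α}
    {u : α → E} (hu : MemLp u ⊤ μ) : ∃ M, 0 ≤ M ∧ ∀ᵐ t ∂μ, ‖u t‖ ≤ M := by
  refine ⟨(eLpNorm u ⊤ μ).toReal, ENNReal.toReal_nonneg, ?_⟩
  filter_upwards [ae_le_eLpNormEssSup (f := u) (μ := μ)] with t ht
  rw [← eLpNorm_exponent_top, ← ofReal_norm] at ht
  exact (ENNReal.ofReal_le_iff_le_toReal hu.eLpNorm_ne_top).1 ht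

lemma gradNormSq_nonneg {L : ℝ} (w : L2Field L) : 0 ≤ gradNormSq w :=
  Finset.sum_nonneg fun _ _ => sq_nonneg _

section LerayHopf

variable {L ν : ℝ} {f : L2Field L} {I : Set ℝ} {u : ℝ → L2Field L}

lemma IsLerayHopfOn.integrableOn_gradNormSq (hu : IsLerayHopfOn ν f I u) {a b : ℝ}
    (h : Set.Icc a b ⊆ I) : IntegrableOn (fun t => gradNormSq (u t)) (Set.Icc a b) := by
  refine integrable_finsetSum _ fun j _ => ?_
  exact (hu.sq_integrable _ h isCompact_Icc j).norm.integrable_sq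

lemma IsLerayHopfOn.integrableOn_norm_sq (hu : IsLerayHopfOn ν f I u) {s : Set ℝ} (h : s ⊆ I)
    (hs : volume s ≠ ⊤) : IntegrableOn (fun t => ‖u t‖ ^ 2) s := by
  have : IsFiniteMeasure (volume.restrict s) := isFiniteMeasure_restrict.2 hs
  have h2 : MemLp u 2 (volume.restrict s) :=
    (hu.bounded.mono_measure (Measure.restrict_mono h le_rfl)).mono_exponent le_top
  exact h2.norm.integrable_sq

lemma IsLerayHopfOn.integrableOn_inner (hu : IsLerayHopfOn ν f I u) {s : Set ℝ} (h : s ⊆ I)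
    (hs : volume s ≠ ⊤) : IntegrableOn (fun t => inner ℝ f (u t)) s := by
  have : IsFiniteMeasure (volume.restrict s) := isFiniteMeasure_restrict.2 hs
  have h1 : MemLp u 1 (volume.restrict s) :=
    (hu.bounded.mono_measure (Measure.restrict_mono h le_rfl)).mono_exponent le_top
  exact (memLp_one_iff_integrable.1 h1).const_inner f

end LerayHopf

/-- The weak global attractor lies in the absorbing ball of radius `‖f‖ / (ν λ₁)`. -/
theorem norm_le_of_mem_weakAttractor {L ν : ℝ} (hL : 0 < L) (hν : 0 < ν) {f w : L2Field L}
    (hw : w ∈ weakAttractor ν f) : ‖w‖ ≤ ‖f‖ / (ν * (2 * Real.pi / L) ^ 2) := by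
  obtain ⟨v, hv, -, rfl⟩ := hw
  have ha : 0 < ν * (2 * Real.pi / L) ^ 2 := by have := Real.pi_pos; positivity
  set a := ν * (2 * Real.pi / L) ^ 2 with hadef
  set F := ‖f‖
  obtain ⟨M, hM0, hM⟩ := exists_ae_norm_le hv.bounded
  rw [Measure.restrict_univ] at hM
  have hy : ∀ s t, IntervalIntegrable (fun r => ‖v r‖ ^ 2) volume s t := fun s t =>
    ⟨hv.integrableOn_norm_sq (Set.subset_univ _) (by simp),
      hv.integrableOn_norm_sq (Set.subset_univ _) (by simp)⟩
  have hfv : ∀ s t, IntervalIntegrable (fun r => inner ℝ f (v r)) volume s t := fun s t =>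
    ⟨hv.integrableOn_inner (Set.subset_univ _) (by simp),
      hv.integrableOn_inner (Set.subset_univ _) (by simp)⟩
  have hV := hv.mem_V
  have hE := hv.energy
  rw [Measure.restrict_univ] at hV hE
  have hz := nonpos_of_bounded_of_decay (z := fun t => ‖v t‖ ^ 2 - (F / a) ^ 2)
    (M := M ^ 2) ha (sq_nonneg (F / a)) (fun s t => (hy s t).sub intervalIntegrable_const)
    (fun t => by linarith [sq_nonneg ‖v t‖])
    (by
      filter_upwards [hM] with t ht
      have := pow_le_pow_left₀ (norm_nonneg _) ht 2
      linarith [sq_nonneg (F / a)])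
    (by
      filter_upwards [hE] with s hs t hst
      have h1 := hs t (Set.mem_univ _) hst
      have hg : IntervalIntegrable (fun r => gradNormSq (v r)) volume s t :=
        (intervalIntegrable_iff_integrableOn_Icc_of_le hst).2
          (hv.integrableOn_gradNormSq (Set.subset_univ _))
      have h2 : (2 * Real.pi / L) ^ 2 * ∫ r in s..t, ‖v r‖ ^ 2 ≤ ∫ r in s..t, gradNormSq (v r) := by
        rw [← intervalIntegral.integral_const_mul]
        refine intervalIntegral.integral_mono_ae hst ((hy s t).const_mul _) hg ?_
        filter_upwards [hV] with r hr using poincare hL hr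
      have h2' := mul_le_mul_of_nonneg_left h2 hν.le
      rw [← mul_assoc, ← hadef] at h2'
      have h3 : ∫ r in s..t, inner ℝ f (v r)
          ≤ ∫ r in s..t, (a * (F / a) ^ 2 / 2 + a / 2 * ‖v r‖ ^ 2) := by
        refine intervalIntegral.integral_mono hst (hfv s t)
          (intervalIntegrable_const.add ((hy s t).const_mul _)) fun r => ?_
        refine (real_inner_le_norm _ _).trans ?_
        have h4 := mul_nonneg ha.le (sq_nonneg (F / a - ‖v r‖))
        have h5 : a * (F / a) = F := by field_simp
        have h6 : ‖f‖ * ‖v r‖ = a * (F / a) * ‖v r‖ := by rw [h5]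
        -- Young's inequality weighted by `a`: half of the Poincaré dissipation absorbs `‖v‖²`.
        rw [h6]
        generalize F / a = q at h4
        nlinarith
      rw [intervalIntegral.integral_add intervalIntegrable_const ((hy s t).const_mul _),
        intervalIntegral.integral_const, intervalIntegral.integral_const_mul, smul_eq_mul] at h3
      rw [intervalIntegral.integral_sub (hy s t) intervalIntegrable_const,
        intervalIntegral.integral_const, smul_eq_mul]
      linarith)
    0
  exact abs_le_of_sq_le_sq' (by linarith) (by positivity) |>.2

/-! ### The energy inequality localized by the cut-off -/

open Filter Topology

/-- The support of a continuous function is open, hence lies in the interior of the interval; so `η`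
vanishes at the endpoints too. -/
lemma eq_zero_of_notMem_Ioo {T : ℝ} {η : ℝ → ℝ} (hη : Continuous η)
    (hsupp : tsupport η ⊆ Set.Icc 0 T) {t : ℝ} (ht : t ∉ Set.Ioo 0 T) : η t = 0 := by
  by_contra h
  have ho : IsOpen (Function.support η) := hη.isOpen_support
  have hsub : Function.support η ⊆ interior (Set.Icc 0 T) :=
    interior_maximal ((subset_tsupport η).trans hsupp) ho
  rw [interior_Icc] at hsub
  exact ht (hsub h)

/-- A nonincreasing function has a nonpositive distributional derivative. -/
lemma integral_deriv_mul_nonneg_of_ae_antitone {T K : ℝ} {η Φ : ℝ → ℝ}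
    (hd : Differentiable ℝ η) (h0 : ∀ t, 0 ≤ η t) (hsupp : tsupport η ⊆ Set.Icc 0 T)
    (hK : ∀ t, |deriv η t| ≤ K) (hΦ : IntegrableOn Φ (Set.Ioc 0 (T + 1)))
    (hanti : ∀ᵐ s ∂(volume.restrict (Set.Ioi 0)), ∀ t, s ≤ t → Φ t ≤ Φ s) :
    0 ≤ ∫ t in Set.Ioc 0 (T + 1), deriv η t * Φ t := by
  set Ψ := (Set.Ioc 0 (T + 1)).indicator Φ with hΨdef
  have hΨ : Integrable Ψ := (integrable_indicator_iff measurableSet_Ioc).2 hΦ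
  have heq : ∫ t in Set.Ioc 0 (T + 1), deriv η t * Φ t = ∫ t, deriv η t * Ψ t := by
    rw [← integral_indicator measurableSet_Ioc]
    refine integral_congr_ae (Eventually.of_forall fun t => ?_)
    by_cases ht : t ∈ Set.Ioc 0 (T + 1) <;> simp [hΨdef, ht]
  have hlip : ∀ x y, |η x - η y| ≤ K * |x - y| := fun x y => by
    simpa using Convex.norm_image_sub_le_of_norm_deriv_le (fun t _ => hd t)
      (fun t _ => hK t) convex_univ (Set.mem_univ y) (Set.mem_univ x)
  have hcs : HasCompactSupport η := isCompact_Icc.of_isClosed_subset (isClosed_tsupport η) hsupp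
  obtain ⟨Cη, hCη⟩ := hcs.exists_bound_of_continuous hd.continuous
  have hprod : ∀ a b : ℝ, Integrable fun t => η (t + a) * Ψ (t + b) := fun a b =>
    (hΨ.comp_add_right b).bdd_mul (c := Cη)
      (hd.continuous.comp (continuous_add_const a)).aestronglyMeasurable
      (Eventually.of_forall fun t => hCη _)
  -- Steps at most 1 keep `t + h n` inside `(0, T + 1]` for `t` in `(0, T)`, where monotonicity is
  -- available.
  set h : ℕ → ℝ := fun n => 1 / ((n : ℝ) + 1) with hh
  have hpos : ∀ n, 0 < h n := fun n => Nat.one_div_pos_of_nat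
  have hle1 : ∀ n, h n ≤ 1 := fun n => by
    rw [hh]; simp only
    rw [div_le_one (by positivity)]
    linarith [(Nat.cast_nonneg n : (0 : ℝ) ≤ n)]
  have hlim : Tendsto (fun n => ∫ t, (-h n)⁻¹ * (η (t + -h n) - η t) * Ψ t) atTop
      (𝓝 (∫ t, deriv η t * Ψ t)) := by
    refine tendsto_integral_of_dominated_convergence (fun t => K * ‖Ψ t‖) (fun n => ?_)
      (hΨ.norm.const_mul K) (fun n => Eventually.of_forall fun t => ?_)
      (Eventually.of_forall fun t => ?_)
    · have hc : Continuous fun t => (-h n)⁻¹ * (η (t + -h n) - η t) := by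
        have := hd.continuous
        fun_prop
      exact hc.aestronglyMeasurable.mul hΨ.aestronglyMeasurable
    · rw [norm_mul]
      refine mul_le_mul_of_nonneg_right ?_ (norm_nonneg _)
      have := hlip (t + -h n) t
      rw [add_sub_cancel_left, abs_neg, abs_of_pos (hpos n)] at this
      rw [Real.norm_eq_abs, abs_mul, abs_inv, abs_neg, abs_of_pos (hpos n),
        inv_mul_le_iff₀ (hpos n)]
      linarith
    · have hs := (hasDerivAt_iff_tendsto_slope_zero.1 (hd t).hasDerivAt)
      have hn : Tendsto (fun n => -h n) atTop (𝓝[≠] 0) := by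
        refine tendsto_nhdsWithin_iff.2 ⟨?_, Eventually.of_forall fun n => ?_⟩
        · simpa [hh] using (tendsto_one_div_add_atTop_nhds_zero_nat (𝕜 := ℝ)).neg
        · simpa using (hpos n).ne'
      simpa using (hs.comp hn).mul_const (Ψ t)
  rw [heq]
  refine ge_of_tendsto' hlim fun n => ?_
  -- Discrete integration by parts: a translation moves the backward difference of `η` to a forward
  -- difference of `Ψ`, which needs no regularity of `Ψ`.
  have hsplit : ∫ t, (-h n)⁻¹ * (η (t + -h n) - η t) * Ψ t
      = (h n)⁻¹ * ∫ t, η t * (Ψ t - Ψ (t + h n)) := by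
    have e1 : ∫ t, η (t + -h n) * Ψ t = ∫ t, η t * Ψ (t + h n) := by
      rw [← integral_add_right_eq_self (fun t => η (t + -h n) * Ψ t) (h n)]
      simp
    have i1 : Integrable fun t => η (t + -h n) * Ψ t := by simpa using hprod (-h n) 0
    have i2 : Integrable fun t => η t * Ψ t := by simpa using hprod 0 0
    have i3 : Integrable fun t => η t * Ψ (t + h n) := by simpa using hprod 0 (h n)
    simp only [mul_assoc, integral_const_mul]
    simp only [sub_mul, mul_sub]
    rw [integral_sub i1 i2, integral_sub i2 i3, e1, inv_neg]
    ring
  rw [hsplit]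
  refine mul_nonneg (inv_nonneg.2 (hpos n).le) (integral_nonneg_of_ae ?_)
  rw [ae_restrict_iff' measurableSet_Ioi] at hanti
  filter_upwards [hanti] with t ht
  by_cases htT : t ∈ Set.Ioo 0 T
  · have m1 : t ∈ Set.Ioc 0 (T + 1) := ⟨htT.1, by linarith [htT.2]⟩
    have m2 : t + h n ∈ Set.Ioc 0 (T + 1) :=
      ⟨by linarith [htT.1, hpos n], by linarith [htT.2, hle1 n]⟩
    simp only [hΨdef, Set.indicator_of_mem m1, Set.indicator_of_mem m2, Pi.zero_apply]
    exact mul_nonneg (h0 t) (sub_nonneg.2 (ht htT.1 _ (by linarith [hpos n])))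
  · simp [eq_zero_of_notMem_Ioo hd.continuous hsupp htT]

/-- The time-localized form of an energy inequality. -/
lemma integral_cutoff_mul_le {T K : ℝ} {η E G : ℝ → ℝ} (hT : 0 < T)
    (hd : Differentiable ℝ η) (h0 : ∀ t, 0 ≤ η t) (hsupp : tsupport η ⊆ Set.Icc 0 T)
    (hK : ∀ t, |deriv η t| ≤ K) (hE : ∀ b, IntegrableOn E (Set.Ioc 0 b))
    (hG : ∀ b, IntegrableOn G (Set.Ioc 0 b))
    (henergy : ∀ᵐ s ∂(volume.restrict (Set.Ioi 0)), ∀ t, s ≤ t → E t + ∫ r in s..t, G r ≤ E s) :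
    ∫ t in (0 : ℝ)..T, η t * G t ≤ ∫ t in (0 : ℝ)..T, deriv η t * E t := by
  have hT1 : (0 : ℝ) ≤ T + 1 := by linarith
  have hGi : ∀ b, 0 ≤ b → IntervalIntegrable G volume 0 b := fun b hb =>
    (intervalIntegrable_iff_integrableOn_Ioc_of_le hb).2 (hG b)
  set P : ℝ → ℝ := fun t => ∫ r in (0 : ℝ)..t, G r with hP
  have hPac : AbsolutelyContinuousOnInterval P 0 (T + 1) :=
    (hGi _ hT1).absolutelyContinuousOnInterval_intervalIntegral (by simp)
  have hPint : IntervalIntegrable P volume 0 (T + 1) := hPac.continuousOn.intervalIntegrable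
  have hηlip : LipschitzWith K.toNNReal η := lipschitzWith_of_nnnorm_deriv_le hd fun t => by
    rw [← NNReal.coe_le_coe, coe_nnnorm, Real.norm_eq_abs]
    exact (hK t).trans (Real.le_coe_toNNReal K)
  have hηac : AbsolutelyContinuousOnInterval η 0 (T + 1) :=
    hηlip.lipschitzOnWith.absolutelyContinuousOnInterval
  have hη0 : η 0 = 0 := eq_zero_of_notMem_Ioo hd.continuous hsupp (by simp)
  have hη1 : η (T + 1) = 0 := eq_zero_of_notMem_Ioo hd.continuous hsupp (by simp)
  -- Both factors are only absolutely continuous; the boundary terms vanish with `η`.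
  have hparts := hηac.integral_mul_deriv_eq_deriv_mul hPac
  have hderiv : ∫ t in (0 : ℝ)..(T + 1), η t * deriv P t = ∫ t in (0 : ℝ)..(T + 1), η t * G t := by
    refine intervalIntegral.integral_congr_ae ?_
    filter_upwards [(hGi _ hT1).ae_hasDerivAt_integral] with t ht ht'
    rw [(ht (Set.uIoc_subset_uIcc ht') 0 (by simp)).deriv]
  rw [hderiv, hη0, hη1] at hparts
  have hdint : ∀ F : ℝ → ℝ, IntervalIntegrable F volume 0 (T + 1) →
      IntervalIntegrable (fun t => deriv η t * F t) volume 0 (T + 1) := fun F hF => by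
    rw [intervalIntegrable_iff] at hF ⊢
    exact hF.bdd_mul (c := K) (measurable_deriv η).aestronglyMeasurable
      (Eventually.of_forall fun t => by simpa using hK t)
  have hEi : IntervalIntegrable E volume 0 (T + 1) :=
    (intervalIntegrable_iff_integrableOn_Ioc_of_le hT1).2 (hE _)
  have hmono := integral_deriv_mul_nonneg_of_ae_antitone (Φ := fun t => E t + P t) hd h0 hsupp hK
    ((intervalIntegrable_iff_integrableOn_Ioc_of_le hT1).1 (hEi.add hPint))
    (by
      filter_upwards [henergy, ae_restrict_mem measurableSet_Ioi] with s hs hs0 t hst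
      have hs0' : (0 : ℝ) < s := hs0
      have := intervalIntegral.integral_interval_sub_left (hGi t (by linarith)) (hGi s hs0'.le)
      have := hs t hst
      simp only [hP]
      linarith)
  rw [← intervalIntegral.integral_of_le hT1] at hmono
  simp only [mul_add] at hmono
  rw [intervalIntegral.integral_add (hdint E hEi) (hdint P hPint)] at hmono
  have hcut : ∀ F : ℝ → ℝ, (∀ t, T < t → F t = 0) →
      ∫ t in (0 : ℝ)..(T + 1), F t = ∫ t in (0 : ℝ)..T, F t := fun F hF => by
    rw [intervalIntegral.integral_of_le hT1, intervalIntegral.integral_of_le hT.le]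
    refine setIntegral_eq_of_subset_of_forall_sdiff_eq_zero measurableSet_Ioc
      (Set.Ioc_subset_Ioc_right (by linarith)) fun t ht => hF t ?_
    by_contra! hle
    exact ht.2 ⟨ht.1.1, hle⟩
  have hηT : ∀ t, T < t → η t = 0 := fun t ht =>
    eq_zero_of_notMem_Ioo hd.continuous hsupp fun h => (h.2.trans ht).false
  have hdT : ∀ t, T < t → deriv η t = 0 := fun t ht => by
    have : η =ᶠ[𝓝 t] fun _ => 0 := by
      filter_upwards [lt_mem_nhds ht] with s hs using hηT s hs
    rw [this.deriv_eq, deriv_const]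
  rw [← hcut (fun t => η t * G t) fun t ht => by simp [hηT t ht],
    ← hcut (fun t => deriv η t * E t) fun t ht => by simp [hdT t ht]]
  linarith

/-- The enstrophy of a Leray–Hopf solution is integrable up to the initial time. -/
lemma IsLerayHopfOn.integrableOn_gradNormSq_Ioc {L ν : ℝ} {f : L2Field L} {u : ℝ → L2Field L}
    (hν : 0 < ν) (hu : IsLerayHopfOn ν f (Set.Ioi 0) u) (b : ℝ) :
    IntegrableOn (fun t => gradNormSq (u t)) (Set.Ioc 0 b) := by
  rcases le_or_gt b 0 with hb | hb
  · simp [Set.Ioc_eq_empty_of_le hb]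
  obtain ⟨M, hM0, hM⟩ := exists_ae_norm_le hu.bounded
  have hgood := hu.energy.and hM
  rw [ae_restrict_iff' measurableSet_Ioi] at hgood
  have hdense := Measure.dense_of_ae hgood
  -- Initial times tending to `0` at which the energy inequality starts and `‖u‖ ≤ M`: they bound
  -- the enstrophy integrals on `(a n, b]` uniformly.
  have hex : ∀ n : ℕ, ∃ s : ℝ, (s ∈ Set.Ioi (0 : ℝ) → (∀ t₁ ∈ Set.Ioi (0 : ℝ), s ≤ t₁ →
      ν * (∫ t in s..t₁, gradNormSq (u t))
      ≤ ‖u s‖ ^ 2 / 2 - ‖u t₁‖ ^ 2 / 2 + ∫ t in s..t₁, inner ℝ f (u t)) ∧ ‖u s‖ ≤ M) ∧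
      s ∈ Set.Ioo 0 (b * (1 / ((n : ℝ) + 1))) := fun n =>
    hdense.exists_between (mul_pos hb Nat.one_div_pos_of_nat)
  choose a ha1 ha2 using hex
  have hab : ∀ n, a n ≤ b := fun n => by
    refine (ha2 n).2.le.trans (mul_le_of_le_one_right hb.le ?_)
    rw [div_le_one (by positivity)]
    linarith [(Nat.cast_nonneg n : (0 : ℝ) ≤ n)]
  have hfu : IntegrableOn (fun t => ‖inner ℝ f (u t)‖) (Set.Ioc 0 b) :=
    (hu.integrableOn_inner (fun t ht => ht.1) (by simp)).norm
  refine integrableOn_Ioc_of_intervalIntegral_norm_bounded_left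
    (I := (M ^ 2 / 2 + ∫ t in Set.Ioc 0 b, ‖inner ℝ f (u t)‖) / ν) (a := a) (l := atTop)
    (fun n => ?_) ?_ (Eventually.of_forall fun n => ?_)
  · exact (hu.integrableOn_gradNormSq
      fun t ht => lt_of_lt_of_le (ha2 n).1 ht.1).mono_set Set.Ioc_subset_Icc_self
  · refine squeeze_zero (fun n => (ha2 n).1.le) (fun n => (ha2 n).2.le) ?_
    simpa using (tendsto_one_div_add_atTop_nhds_zero_nat (𝕜 := ℝ)).const_mul b
  · obtain ⟨he, hMn⟩ := ha1 n (ha2 n).1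
    have h1 := he b hb (hab n)
    have h2 : ∫ t in (a n)..b, inner ℝ f (u t) ≤ ∫ t in Set.Ioc 0 b, ‖inner ℝ f (u t)‖ := by
      rw [intervalIntegral.integral_of_le (hab n)]
      refine (Real.le_norm_self _).trans ((norm_integral_le_integral_norm _).trans ?_)
      exact setIntegral_mono_set hfu (Eventually.of_forall fun t => norm_nonneg _)
        (Set.Ioc_subset_Ioc_left (ha2 n).1.le).eventuallyLE
    have h3 := pow_le_pow_left₀ (norm_nonneg _) hMn 2
    simp only [Real.norm_of_nonneg (gradNormSq_nonneg _)]
    rw [← intervalIntegral.integral_of_le (hab n), le_div_iff₀ hν]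
    linarith [sq_nonneg ‖u b‖]

/-- Nonnegativity of the variance about the mean `m`. -/
lemma sq_integral_le_mul_integral_sq {T : ℝ} (hT : 0 < T) {b : ℝ → ℝ}
    (hb : IntervalIntegrable b volume 0 T)
    (hb2 : IntervalIntegrable (fun t => b t ^ 2) volume 0 T) :
    (∫ t in (0 : ℝ)..T, b t) ^ 2 ≤ T * ∫ t in (0 : ℝ)..T, b t ^ 2 := by
  set m := (∫ t in (0 : ℝ)..T, b t) / T with hm
  have h1 : 0 ≤ ∫ t in (0 : ℝ)..T, (b t - m) ^ 2 :=
    intervalIntegral.integral_nonneg hT.le fun t _ => sq_nonneg _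
  have h2 : ∫ t in (0 : ℝ)..T, (b t - m) ^ 2
      = (∫ t in (0 : ℝ)..T, b t ^ 2) - 2 * m * (∫ t in (0 : ℝ)..T, b t) + T * m ^ 2 := by
    have : (fun t => (b t - m) ^ 2) = fun t => b t ^ 2 - 2 * m * b t + m ^ 2 := by
      ext t; ring
    rw [this, intervalIntegral.integral_add (hb2.sub (hb.const_mul _)) intervalIntegrable_const,
      intervalIntegral.integral_sub hb2 (hb.const_mul _), intervalIntegral.integral_const_mul,
      intervalIntegral.integral_const, sub_zero, smul_eq_mul]
  have h3 : ∫ t in (0 : ℝ)..T, b t = T * m := by rw [hm]; field_simp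
  rw [h2] at h1
  rw [h3] at h1 ⊢
  nlinarith

end PeriodicNSE

end

/-! ### The bound on the total dissipation -/

open PeriodicNSE in
theorem theorem2 (R₀ ν C₀ δ T : ℝ) (hR₀ : 0 < R₀) (hν : 0 < ν) (hC₀ : 0 < C₀)
    (hδ : δ ∈ Set.Ioo (1 / 2 : ℝ) 1)
    (hT : 2 * C₀ / Real.pi ^ 2 * (R₀ ^ 2 / ν) ≤ T)
    (η : ℝ → ℝ) (hη : PeriodicNSE.IsRefinedTimeCutoff C₀ δ T η)
    (f : PeriodicNSE.L2Field (4 * R₀)) (hf : f ∈ PeriodicNSE.spaceH (4 * R₀))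
    (u : ℝ → PeriodicNSE.L2Field (4 * R₀))
    (hu : PeriodicNSE.IsLerayHopfOn ν f (Set.Ioi 0) u)
    (hA : ∀ t ∈ Set.Icc 0 T, u t ∈ PeriodicNSE.weakAttractor ν f) :
    IntervalIntegrable (fun t => η t * PeriodicNSE.gradNormSq (u t)) MeasureTheory.volume 0 T ∧
    0 ≤ PeriodicNSE.anomalousDissipation R₀ ν T f η u ∧
    PeriodicNSE.globalDissipation R₀ ν T f η u
      ≤ 2 * Real.sqrt 2 * (‖f‖ / R₀ ^ (3 / 2 : ℝ))
          * Real.sqrt (PeriodicNSE.globalEnergy R₀ δ T η u) := by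
  have hπ := Real.pi_pos
  have hT0 : 0 < T := lt_of_lt_of_le (by positivity) hT
  have hδ0 : 0 < δ := by linarith [hδ.1]
  have hηc : Continuous η := hη.differentiable.continuous
  have hpow_le : ∀ t, η t ^ δ ≤ 1 := fun t => Real.rpow_le_one (hη.nonneg t) (hη.le_one t) hδ0.le
  have hpow_nonneg : ∀ t, 0 ≤ η t ^ δ := fun t => Real.rpow_nonneg (hη.nonneg t) _
  have hKnonneg : 0 ≤ C₀ / T := by positivity
  have hK : ∀ t, |deriv η t| ≤ C₀ / T := fun t =>
    (hη.deriv_bound t).trans (mul_le_of_le_one_right hKnonneg (hpow_le t))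
  have hgrad := hu.integrableOn_gradNormSq_Ioc hν
  have hsub : ∀ b : ℝ, Set.Ioc 0 b ⊆ Set.Ioi 0 := fun b t ht => ht.1
  have hyint : ∀ b : ℝ, IntegrableOn (fun t => ‖u t‖ ^ 2) (Set.Ioc 0 b) := fun b =>
    hu.integrableOn_norm_sq (hsub b) (by simp)
  have hfint : ∀ b : ℝ, IntegrableOn (fun t => inner ℝ f (u t)) (Set.Ioc 0 b) := fun b =>
    hu.integrableOn_inner (hsub b) (by simp)
  have hg : IntervalIntegrable (fun t => gradNormSq (u t)) volume 0 T :=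
    (intervalIntegrable_iff_integrableOn_Ioc_of_le hT0.le).2 (hgrad T)
  have hy : IntervalIntegrable (fun t => ‖u t‖ ^ 2) volume 0 T :=
    (intervalIntegrable_iff_integrableOn_Ioc_of_le hT0.le).2 (hyint T)
  have hfu : IntervalIntegrable (fun t => inner ℝ f (u t)) volume 0 T :=
    (intervalIntegrable_iff_integrableOn_Ioc_of_le hT0.le).2 (hfint T)
  have hηg : IntervalIntegrable (fun t => η t * gradNormSq (u t)) volume 0 T :=
    hg.continuousOn_mul hηc.continuousOn
  have hηf : IntervalIntegrable (fun t => η t * inner ℝ f (u t)) volume 0 T :=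
    hfu.continuousOn_mul hηc.continuousOn
  have hc : 0 < 1 / T * (1 / R₀ ^ 3) := by positivity
  -- This inequality is the nonnegativity of the anomalous dissipation, up to the factor `1/(T
  -- R₀³)`.
  have hbalance := integral_cutoff_mul_le (E := fun t => ‖u t‖ ^ 2 / 2)
    (G := fun t => ν * gradNormSq (u t) - inner ℝ f (u t)) hT0 hη.differentiable hη.nonneg
    hη.support_subset hK (fun b => (hyint b).div_const 2)
    (fun b => ((hgrad b).const_mul ν).sub (hfint b))
    (by
      filter_upwards [hu.energy, ae_restrict_mem measurableSet_Ioi] with s hs hs0 t hst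
      have h0t : t ∈ Set.Ioi (0 : ℝ) := lt_of_lt_of_le hs0 hst
      have hIoc : Set.Ioc s t ⊆ Set.Ioc 0 t := Set.Ioc_subset_Ioc_left (le_of_lt hs0)
      have i1 : IntervalIntegrable (fun r => gradNormSq (u r)) volume s t :=
        (intervalIntegrable_iff_integrableOn_Ioc_of_le hst).2 ((hgrad t).mono_set hIoc)
      have i2 : IntervalIntegrable (fun r => inner ℝ f (u r)) volume s t :=
        (intervalIntegrable_iff_integrableOn_Ioc_of_le hst).2 ((hfint t).mono_set hIoc)
      rw [intervalIntegral.integral_sub (i1.const_mul ν) i2, intervalIntegral.integral_const_mul]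
      linarith [hs t h0t hst])
  have hsplit : ∫ t in (0 : ℝ)..T, η t * (ν * gradNormSq (u t) - inner ℝ f (u t))
      = ν * (∫ t in (0 : ℝ)..T, η t * gradNormSq (u t))
        - ∫ t in (0 : ℝ)..T, η t * inner ℝ f (u t) := by
    rw [← intervalIntegral.integral_const_mul,
      ← intervalIntegral.integral_sub (hηg.const_mul ν) hηf]
    congr 1
    ext t
    ring
  rw [hsplit] at hbalance
  refine ⟨hηg, ?_, ?_⟩
  · rw [anomalousDissipation, balanceRate, viscousDissipation, ← mul_add, ← mul_sub]
    exact mul_nonneg hc.le (by linarith)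
  set X := ∫ t in (0 : ℝ)..T, η t ^ δ * ‖u t‖ ^ 2 with hX
  set a := ν * (2 * Real.pi / (4 * R₀)) ^ 2 with hadef
  have ha : 0 < a := by positivity
  have hbound : ∀ t ∈ Set.Icc 0 T, ‖u t‖ ≤ ‖f‖ / a := fun t ht =>
    norm_le_of_mem_weakAttractor (by positivity) hν (hA t ht)
  have hXint : IntervalIntegrable (fun t => η t ^ δ * ‖u t‖ ^ 2) volume 0 T :=
    hy.continuousOn_mul (hηc.rpow_const fun _ => Or.inr hδ0.le).continuousOn
  have hX0 : 0 ≤ X := intervalIntegral.integral_nonneg hT0.le fun t _ =>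
    mul_nonneg (hpow_nonneg t) (sq_nonneg _)
  have hXle : X ≤ T * (‖f‖ / a) ^ 2 := by
    have h1 : X ≤ ∫ _t in (0 : ℝ)..T, (‖f‖ / a) ^ 2 := by
      refine intervalIntegral.integral_mono_on hT0.le hXint intervalIntegrable_const fun t ht => ?_
      exact (mul_le_of_le_one_left (sq_nonneg _) (hpow_le t)).trans
        (pow_le_pow_left₀ (norm_nonneg _) (hbound t ht) 2)
    simpa using h1
  have hderiv : ∫ t in (0 : ℝ)..T, deriv η t * (‖u t‖ ^ 2 / 2) ≤ C₀ / T * (X / 2) := by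
    have h1 : ∫ t in (0 : ℝ)..T, deriv η t * (‖u t‖ ^ 2 / 2)
        ≤ ∫ t in (0 : ℝ)..T, C₀ / T / 2 * (η t ^ δ * ‖u t‖ ^ 2) := by
      refine intervalIntegral.integral_mono hT0.le ?_ (hXint.const_mul _) fun t => ?_
      · rw [intervalIntegrable_iff]
        exact (intervalIntegrable_iff.1 (hy.div_const 2)).bdd_mul (c := C₀ / T)
          (measurable_deriv η).aestronglyMeasurable
          (Filter.Eventually.of_forall fun t => by simpa using hK t)
      · have h2 := mul_le_mul_of_nonneg_right ((le_abs_self _).trans (hη.deriv_bound t))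
          (by positivity : 0 ≤ ‖u t‖ ^ 2 / 2)
        simp only
        linarith
    rw [intervalIntegral.integral_const_mul] at h1
    linarith
  have hforce : ∫ t in (0 : ℝ)..T, η t * inner ℝ f (u t) ≤ ‖f‖ * Real.sqrt (T * X) := by
    have hsq : ∀ t, (η t ^ (δ / 2) * ‖u t‖) ^ 2 = η t ^ δ * ‖u t‖ ^ 2 := fun t => by
      rw [mul_pow, ← Real.rpow_natCast (η t ^ (δ / 2)), ← Real.rpow_mul (hη.nonneg t)]
      norm_num
    have hui : IntervalIntegrable (fun t => ‖u t‖) volume 0 T := by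
      rw [intervalIntegrable_iff_integrableOn_Ioc_of_le hT0.le]
      exact (memLp_one_iff_integrable.1 ((hu.bounded.mono_measure
        (Measure.restrict_mono (hsub T) le_rfl)).mono_exponent le_top)).norm
    have hbi : IntervalIntegrable (fun t => η t ^ (δ / 2) * ‖u t‖) volume 0 T :=
      hui.continuousOn_mul (hηc.rpow_const fun _ => Or.inr (by linarith)).continuousOn
    have hcs := sq_integral_le_mul_integral_sq hT0 hbi (by simpa only [hsq] using hXint)
    simp only [hsq] at hcs
    have h1 : ∫ t in (0 : ℝ)..T, η t * inner ℝ f (u t)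
        ≤ ∫ t in (0 : ℝ)..T, ‖f‖ * (η t ^ (δ / 2) * ‖u t‖) := by
      refine intervalIntegral.integral_mono hT0.le hηf (hbi.const_mul _) fun t => ?_
      have h2 : η t ≤ η t ^ (δ / 2) := by
        rcases (hη.nonneg t).eq_or_lt with h | h
        · rw [← h]; exact Real.rpow_nonneg le_rfl _
        · simpa using Real.rpow_le_rpow_of_exponent_ge h (hη.le_one t)
            (by linarith [hδ.2] : δ / 2 ≤ 1)
      calc η t * inner ℝ f (u t) ≤ η t * (‖f‖ * ‖u t‖) :=
            mul_le_mul_of_nonneg_left (real_inner_le_norm _ _) (hη.nonneg t)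
        _ ≤ η t ^ (δ / 2) * (‖f‖ * ‖u t‖) := mul_le_mul_of_nonneg_right h2 (by positivity)
        _ = ‖f‖ * (η t ^ (δ / 2) * ‖u t‖) := by ring
    rw [intervalIntegral.integral_const_mul] at h1
    exact h1.trans (mul_le_mul_of_nonneg_left (Real.le_sqrt_of_sq_le hcs) (norm_nonneg _))
  have hCT : C₀ / T ≤ 2 * a := by
    rw [div_le_iff₀ hT0]
    calc C₀ = 2 * a * (2 * C₀ / Real.pi ^ 2 * (R₀ ^ 2 / ν)) := by
          rw [hadef]; field_simp; norm_num
      _ ≤ 2 * a * T := mul_le_mul_of_nonneg_left hT (by positivity)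
  -- One factor `X` of `(aX)²` is replaced by its absorbing-ball bound, the other is kept, so that a
  -- square root of `X` survives.
  have haX : a * X ≤ ‖f‖ * Real.sqrt (T * X) := by
    have h1 : (a * X) ^ 2 ≤ (‖f‖ * Real.sqrt (T * X)) ^ 2 := by
      rw [mul_pow ‖f‖, Real.sq_sqrt (by positivity)]
      calc (a * X) ^ 2 = a ^ 2 * X * X := by ring
        _ ≤ a ^ 2 * X * (T * (‖f‖ / a) ^ 2) := mul_le_mul_of_nonneg_left hXle (by positivity)
        _ = ‖f‖ ^ 2 * (T * X) := by field_simp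
    exact abs_le_of_sq_le_sq' h1 (by positivity) |>.2
  have htotal : (∫ t in (0 : ℝ)..T, deriv η t * (‖u t‖ ^ 2 / 2))
      + ∫ t in (0 : ℝ)..T, η t * inner ℝ f (u t) ≤ 2 * (‖f‖ * Real.sqrt (T * X)) := by
    have := mul_le_mul_of_nonneg_right hCT (by positivity : 0 ≤ X / 2)
    linarith
  have hleft : globalDissipation R₀ ν T f η u
      = 1 / T * (1 / R₀ ^ 3) * ((∫ t in (0 : ℝ)..T, deriv η t * (‖u t‖ ^ 2 / 2))
          + ∫ t in (0 : ℝ)..T, η t * inner ℝ f (u t)) := by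
    rw [globalDissipation, anomalousDissipation, balanceRate]
    ring
  have henergy : globalEnergy R₀ δ T η u = T * X * (1 / (2 * T ^ 2 * R₀ ^ 3)) := by
    have : ∫ t in (0 : ℝ)..T, η t ^ δ * (‖u t‖ ^ 2 / 2) = X / 2 := by
      rw [hX, ← intervalIntegral.integral_div]
      congr 1
      ext t
      ring
    rw [globalEnergy, this]
    field_simp
  have hR32 : R₀ ^ (3 / 2 : ℝ) = Real.sqrt (R₀ ^ 3) := by
    rw [Real.sqrt_eq_rpow, ← Real.rpow_natCast, ← Real.rpow_mul hR₀.le]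
    norm_num
  have hright : 2 * Real.sqrt 2 * (‖f‖ / R₀ ^ (3 / 2 : ℝ)) * Real.sqrt (globalEnergy R₀ δ T η u)
      = 1 / T * (1 / R₀ ^ 3) * (2 * (‖f‖ * Real.sqrt (T * X))) := by
    rw [henergy, hR32, Real.sqrt_mul (by positivity), Real.sqrt_div zero_le_one, Real.sqrt_one,
      Real.sqrt_mul (by positivity), Real.sqrt_mul (by positivity),
      Real.sqrt_mul zero_le_two, Real.sqrt_sq hT0.le]
    have h2 : Real.sqrt 2 ≠ 0 := by positivity
    have h3 : Real.sqrt (R₀ ^ 3) ≠ 0 := by positivity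
    have h4 : Real.sqrt (R₀ ^ 3) * Real.sqrt (R₀ ^ 3) = R₀ ^ 3 := Real.mul_self_sqrt (by positivity)
    generalize Real.sqrt (R₀ ^ 3) = q at h3 h4
    rw [← h4]
    field_simp
  rw [hleft, hright]
  exact mul_le_mul_of_nonneg_left htotal hc.le
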